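/- Let $X$ be a compact Hausdorff space, $\mu$ a regular Borel probability measure on $X$, $N>1$ an integer, and $\varphi\colon X\to X$ a map such that: 1. $\varphi$ is a local homeomorphism and every point of $X$ has exactly $N$ pre-images under $\varphi$; 2. $U_1,\dots,U_N\subseteq X$ are pairwise disjoint open sets such that $\varphi|_{U_i}$ is one-to-one for all $i$, $\varphi(U_i)=\varphi(U_j)$ for all $i,j$, $X=\bigcup_{i=1}^N (U_i\cup\partial U_i)$, $X=\varphi(U_i)\cup\partial\varphi(U_i)$ for all $i$, and $\mu(\partial U_i)=0$ for all $i$; 3. $\varphi$ preserves null sets in both directions, i.e. $\mu(E)=0$ implies $\mu(\varphi^{-1}(E))=0$ (which holds in particular if $\varphi$ preserves $\mu$) and $\mu(\varphi(E))=0$, for every Borel set $E$; and $\varphi$ is ergodic, i.e. every Borel set $E$ with $\varphi^{-1}(E)=E$ satisfies $\mu(E)\in\{0,1\}$; 4. the cylinder sets $U_{i_1\dots i_k}=\{x\in X : x\in U_{i_1},\ \varphi(x)\in U_{i_2},\dots,\varphi^{k-1}(x)\in U_{i_k}\}$, over all finite words $i_1\dots i_k$ in $\{1,\dots,N\}$,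 generate the Borel $\sigma$-algebra up to null sets: for every Borel set $E$ there is $F$ in the $\sigma$-algebra generated by the cylinder sets with $\mu(E\,\triangle\,F)=0$. For $f\in L^\infty(X,\mu)$ let $M_f$ be the operator of multiplication by $f$ on the complex Hilbert space $L^2(X,\mu)$. Then there is a Cuntz family $S_1,\dots,S_N\in\mathcal B(L^2(X,\mu))$, i.e. $S_i^*S_j=\delta_{ij}I$ and $\sum_{i=1}^N S_iS_i^*=I$, such that the $*$-endomorphism $\alpha_S(T)=\sum_{i=1}^N S_iTS_i^*$ of $\mathcal B(L^2(X,\mu))$ extends $\alpha\colon M_f\mapsto M_{f\circ\varphi}$, i.e. $\alpha_S(M_f)=M_{f\circ\varphi}$ for all $f\in L^\infty(X,\mu)$, and such that $\alpha_S$ is ergodic, i.e. $\{T\in\mathcal B(L^2(X,\mu)) : \alpha_S(T)=T\}=\mathbb C I$. Furthermore, the representation on $L^2(X,\mu)$ of the Cuntz algebra $\mathcal O_N=C^*(S_1,\dots,S_N)$ given by this Cuntz family (the inclusion $\mathcal O_N\subseteq\mathcal B(L^2(X,\mu))$) is irreducible. -/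

import Mathlib

open MeasureTheory Set
open scoped ENNReal

namespace CuntzErgodic

noncomputable section

/-! ### Dynamics on the space -/

section Dynamics

variable {X : Type*}

/-- A family `U₁, …, U_N` of pairwise disjoint open sets on each of which `φ` is injective, with
the same image under `φ`, such that the closures of the `U i` cover the space and the common image
is dense. -/
structure IsDecomposition [TopologicalSpace X] (φ : X → X) {N : ℕ} (U : Fin N → Set X) :
    Prop where
  isOpen : ∀ i, IsOpen (U i)
  disjoint : ∀ i j, i ≠ j → Disjoint (U i) (U j)
  injOn : ∀ i, InjOn φ (U i)
  image_eq : ∀ i j, φ '' U i = φ '' U j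
  cover : ⋃ i, (U i ∪ frontier (U i)) = univ
  image_cover : ∀ i, φ '' U i ∪ frontier (φ '' U i) = univ

/-- The cylinder set `U_{i₁ … i_k} = {x | x ∈ U_{i₁}, φ x ∈ U_{i₂}, …, φ^{k-1} x ∈ U_{i_k}}` of a
finite word `w = i₁ … i_k`. -/
def cylinder (φ : X → X) {N : ℕ} (U : Fin N → Set X) {k : ℕ} (w : Fin k → Fin N) : Set X :=
  {x | ∀ j : Fin k, φ^[(j : ℕ)] x ∈ U (w j)}

/-- The σ-algebra generated by the cylinder sets of all finite words. -/
abbrev cylinderSigma (φ : X → X) {N : ℕ} (U : Fin N → Set X) : MeasurableSpace X :=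
  MeasurableSpace.generateFrom {s | ∃ (k : ℕ) (w : Fin k → Fin N), s = cylinder φ U w}

/-- The cylinder sets generate the σ-algebra of `X` up to sets of measure zero: every measurable
set agrees, up to a null set, with a member of the σ-algebra generated by the cylinders. -/
def CylindersGenerate [MeasurableSpace X] (μ : Measure X) (φ : X → X) {N : ℕ}
    (U : Fin N → Set X) : Prop :=
  ∀ E : Set X, MeasurableSet E → ∃ F : Set X, MeasurableSet[cylinderSigma φ U] F ∧ E =ᵐ[μ] F

/-- Images under `φ` of null sets are null sets. -/
def PreservesNullSets [MeasurableSpace X] (μ : Measure X) (φ : X → X) : Prop :=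
  ∀ E : Set X, MeasurableSet E → μ E = 0 → μ (φ '' E) = 0

end Dynamics

/-! ### Multiplication operators and composition -/

section Multiplication

variable {X : Type*} [MeasurableSpace X] {μ : Measure X}

/-- The multiplication operator `M_f` on `L²(X, μ)`, for `f ∈ L^∞(X, μ)`. -/
def mulOp (f : Lp ℂ ∞ μ) : Lp ℂ 2 μ →L[ℂ] Lp ℂ 2 μ :=
  (ContinuousLinearMap.mul ℂ ℂ).holderL μ ∞ 2 2 f

theorem coeFn_mulOp (f : Lp ℂ ∞ μ) (g : Lp ℂ 2 μ) : mulOp f g =ᵐ[μ] fun x => f x * g x :=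
  (ContinuousLinearMap.mul ℂ ℂ).coeFn_holder f g

theorem memLp_top_comp {φ : X → X} (hφ : Measure.QuasiMeasurePreserving φ μ μ) (f : Lp ℂ ∞ μ) :
    AEEqFun.compQuasiMeasurePreserving (f : X →ₘ[μ] ℂ) φ hφ ∈ Lp ℂ ∞ μ := by
  rw [Lp.mem_Lp_iff_memLp]
  have h : MemLp (f ∘ φ) ∞ μ := by
    refine memLp_top_of_bound
      ((Lp.aestronglyMeasurable f).comp_quasiMeasurePreserving hφ) ‖f‖ ?_
    have hb : ∀ᵐ x ∂μ, ‖f x‖ ≤ ‖f‖ := by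
      have h1 := ae_le_eLpNormEssSup (f := f) (μ := μ)
      filter_upwards [h1] with x hx
      rw [Lp.norm_def, eLpNorm_exponent_top, ← toReal_enorm]
      refine ENNReal.toReal_mono ?_ hx
      have := Lp.eLpNorm_ne_top f
      rwa [eLpNorm_exponent_top] at this
    exact hφ.ae hb
  exact h.ae_eq (AEEqFun.coeFn_compQuasiMeasurePreserving _ hφ).symm

/-- The map `f ↦ f ∘ φ` on `L^∞(X, μ)`, for `φ` such that preimages of null sets are null. -/
def compLinfty (φ : X → X) (hφ : Measure.QuasiMeasurePreserving φ μ μ) (f : Lp ℂ ∞ μ) :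
    Lp ℂ ∞ μ :=
  ⟨AEEqFun.compQuasiMeasurePreserving (f : X →ₘ[μ] ℂ) φ hφ, memLp_top_comp hφ f⟩

theorem coeFn_compLinfty (φ : X → X) (hφ : Measure.QuasiMeasurePreserving φ μ μ) (f : Lp ℂ ∞ μ) :
    compLinfty φ hφ f =ᵐ[μ] f ∘ φ :=
  AEEqFun.coeFn_compQuasiMeasurePreserving _ hφ

end Multiplication

/-! ### Cuntz families, their endomorphisms and their C*-algebras -/

section Cuntz

variable {H : Type*} [NormedAddCommGroup H] [InnerProductSpace ℂ H] [CompleteSpace H]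

/-- A Cuntz family: isometries `S₁, …, S_N` with pairwise orthogonal ranges that sum up to the
whole Hilbert space. -/
structure IsCuntzFamily {N : ℕ} (S : Fin N → H →L[ℂ] H) : Prop where
  isometry : ∀ i, star (S i) * S i = 1
  orthogonal : ∀ i j, i ≠ j → star (S i) * S j = 0
  sum_eq_one : ∑ i, S i * star (S i) = 1

/-- The unital `*`-endomorphism `T ↦ ∑ i, S i * T * (S i)^*` of `B(H)` implemented by a Cuntz
family. -/
def IsCuntzFamily.endomorphism {N : ℕ} {S : Fin N → H →L[ℂ] H} (hS : IsCuntzFamily S) :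
    (H →L[ℂ] H) →⋆ₐ[ℂ] (H →L[ℂ] H) where
  toFun T := ∑ i, S i * T * star (S i)
  map_one' := by simpa using hS.sum_eq_one
  map_mul' T R := by
    rw [Finset.sum_mul_sum]
    refine Finset.sum_congr rfl fun i _ => ?_
    rw [Finset.sum_eq_single i]
    · calc S i * (T * R) * star (S i) = S i * T * 1 * R * star (S i) := by
            simp only [mul_assoc, one_mul]
        _ = S i * T * star (S i) * (S i * R * star (S i)) := by
            rw [← hS.isometry i]; simp only [mul_assoc]
    · intro j _ hj
      calc S i * T * star (S i) * (S j * R * star (S j))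
          = S i * T * (star (S i) * S j) * R * star (S j) := by simp only [mul_assoc]
        _ = 0 := by rw [hS.orthogonal i j hj.symm]; simp
    · intro h; exact absurd (Finset.mem_univ i) h
  map_zero' := by simp
  map_add' T R := by simp only [mul_add, add_mul, Finset.sum_add_distrib]
  commutes' c := by
    simp only [Algebra.algebraMap_eq_smul_one, mul_smul_comm, smul_mul_assoc, mul_one,
      ← Finset.smul_sum, hS.sum_eq_one]
  map_star' T := by simp only [star_sum, star_mul, star_star, mul_assoc]

/-- An endomorphism of `B(H)` is ergodic if its fixed points are exactly the scalars. -/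
def IsErgodicEndomorphism (β : (H →L[ℂ] H) →⋆ₐ[ℂ] (H →L[ℂ] H)) : Prop :=
  {T | β T = T} = range fun c : ℂ => c • (1 : H →L[ℂ] H)

/-- The C*-algebra `C*(S₁, …, S_N)` generated by the `S i` inside `B(H)`; for a Cuntz family with
`N > 1` this is the Cuntz algebra `O_N`. -/
def cuntzAlgebra {N : ℕ} (S : Fin N → H →L[ℂ] H) : StarSubalgebra ℂ (H →L[ℂ] H) :=
  (StarAlgebra.adjoin ℂ (range S)).topologicalClosure

/-- A representation of a unital `*`-algebra on a Hilbert space is irreducible if the space is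
nonzero and its only closed invariant subspaces are `0` and the whole space. -/
def IsIrreducibleRep {A : Type*} [Semiring A] [Algebra ℂ A] [StarRing A]
    (π : A →⋆ₐ[ℂ] (H →L[ℂ] H)) : Prop :=
  Nontrivial H ∧ ∀ K : Submodule ℂ H, IsClosed (K : Set H) →
    (∀ (a : A), ∀ x ∈ K, π a x ∈ K) → K = ⊥ ∨ K = ⊤

end Cuntz

end

end CuntzErgodic

/-! Put `S i g = 1_{U i} · (h i ∘ φ) · (g ∘ φ)`, where `(h i)²` is the density of `μ` with respect
to the image under `φ` of `μ` restricted to `U i`. The two measures have the same null sets, so `h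
i` is a.e. nonzero. The density makes `S i` isometric and injectivity of `φ` on `U i` makes its
range all of `L²(U i)`. The `U i` partition `X` up to a null set, so the `S i` form a Cuntz family,
and `S i M_f (S i)^*` is multiplication by `1_{U i} · (f ∘ φ)`; summing gives `M_{f ∘ φ}`.

Fixed points of the endomorphism commute with all `S i` and `(S i)^*`. Such a `T` commutes with
indicators of cylinders, which generate, so `T` is multiplication by `T 1`
(`ae_eq_mul_of_commute_indOp`). Commuting with `S i` then forces `T 1 ∘ φ = T 1` a.e., and
ergodicity makes `T 1` constant (`eq_smul_one_of_commute`). Irreducibility follows since the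
projection onto an invariant subspace is such a `T`. -/

namespace CuntzErgodic

/-! ### Weighted composition isometries -/

section Branch

variable {X : Type*} [MeasurableSpace X] {μ : Measure X}

/-- The weight `h` is the square root of the density of `μ` with respect to the image under `φ`
of the restriction of `μ` to `A`. -/
theorem exists_weight [IsFiniteMeasure μ] {φ : X → X}
    (hφ : Measure.QuasiMeasurePreserving φ μ μ) {A : Set X}
    (hac : μ ≪ (μ.restrict A).map φ) :
    ∃ h : X → ℂ, Measurable h ∧ (∀ᵐ y ∂μ, h y ≠ 0) ∧
      ∀ F : X → ℝ≥0∞, AEMeasurable F μ →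
        ∫⁻ x in A, ‖h (φ x)‖ₑ ^ 2 * F (φ x) ∂μ = ∫⁻ y, F y ∂μ := by
  set ν := (μ.restrict A).map φ with hν
  have hνμ : ν ≪ μ :=
    (Measure.AbsolutelyContinuous.map Measure.restrict_le_self.absolutelyContinuous
      hφ.measurable).trans hφ.absolutelyContinuous
  have hρm : Measurable (μ.rnDeriv ν) := Measure.measurable_rnDeriv μ ν
  have hlt : ∀ᵐ y ∂ν, μ.rnDeriv ν y < ∞ := Measure.rnDeriv_lt_top μ ν
  have hm : Measurable fun y => (Real.sqrt (μ.rnDeriv ν y).toReal : ℂ) :=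
    Complex.measurable_ofReal.comp hρm.ennreal_toReal.sqrt
  refine ⟨fun y => (Real.sqrt (μ.rnDeriv ν y).toReal : ℂ), hm, ?_, fun F hF => ?_⟩
  · filter_upwards [Measure.rnDeriv_pos hac, hac.ae_le hlt] with y h0 h1
    rw [Complex.ofReal_ne_zero]
    exact (Real.sqrt_pos.2 (ENNReal.toReal_pos h0.ne' h1.ne)).ne'
  · have hsq : ∀ᵐ y ∂ν, ‖(Real.sqrt (μ.rnDeriv ν y).toReal : ℂ)‖ₑ ^ 2 = μ.rnDeriv ν y := by
      filter_upwards [hlt] with y hy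
      rw [← ofReal_norm, Complex.norm_real, Real.norm_of_nonneg (Real.sqrt_nonneg _),
        ← ENNReal.ofReal_pow (Real.sqrt_nonneg _), Real.sq_sqrt ENNReal.toReal_nonneg,
        ENNReal.ofReal_toReal hy.ne]
    have hFν : AEMeasurable F ν := hF.mono_ac hνμ
    calc _ = ∫⁻ y, ‖(Real.sqrt (μ.rnDeriv ν y).toReal : ℂ)‖ₑ ^ 2 * F y ∂ν := by
          rw [hν, lintegral_map' _ hφ.measurable.aemeasurable]
          exact (hm.enorm.pow_const 2).aemeasurable.mul hFν
      _ = ∫⁻ y, (μ.rnDeriv ν * F) y ∂ν :=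
          lintegral_congr_ae (hsq.mono fun y hy => by simp only [hy, Pi.mul_apply])
      _ = ∫⁻ y, F y ∂(ν.withDensity (μ.rnDeriv ν)) :=
          (lintegral_withDensity_eq_lintegral_mul₀ hρm.aemeasurable hFν).symm
      _ = _ := by rw [Measure.withDensity_rnDeriv_eq _ _ hac]

/-- `S` is an isometry onto `L²(A)` of the form `g ↦ 1_A · (h ∘ φ) · (g ∘ φ)`, with a weight `h`
that vanishes almost nowhere. -/
structure IsBranchIsometry (φ : X → X) (A : Set X) (S : Lp ℂ 2 μ →L[ℂ] Lp ℂ 2 μ) : Prop where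
  isometry : star S * S = 1
  mul_star : ∀ g, S (star S g) =ᵐ[μ] A.indicator g
  exists_weight : ∃ h : X → ℂ, (∀ᵐ y ∂μ, h y ≠ 0) ∧
    ∀ g, S g =ᵐ[μ] A.indicator fun x => h (φ x) * g (φ x)

theorem eLpNorm_two_eq_of_lintegral_eq {f g : X → ℂ}
    (h : ∫⁻ x, ‖f x‖ₑ ^ 2 ∂μ = ∫⁻ x, ‖g x‖ₑ ^ 2 ∂μ) : eLpNorm f 2 μ = eLpNorm g 2 μ := by
  rw [eLpNorm_eq_lintegral_rpow_enorm_toReal (by simp) (by simp),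
    eLpNorm_eq_lintegral_rpow_enorm_toReal (by simp) (by simp)]
  simpa using congrArg (fun t : ℝ≥0∞ => t ^ (1 / 2 : ℝ)) h

theorem lintegral_enorm_sq_indicator {A : Set X} (hA : MeasurableSet A) (f : X → ℂ) :
    ∫⁻ x, ‖A.indicator f x‖ₑ ^ 2 ∂μ = ∫⁻ x in A, ‖f x‖ₑ ^ 2 ∂μ := by
  rw [← lintegral_indicator hA]
  refine lintegral_congr fun x => ?_
  by_cases hx : x ∈ A <;> simp [hx]

theorem exists_isBranchIsometry [IsFiniteMeasure μ] {φ : X → X}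
    (hφ : Measure.QuasiMeasurePreserving φ μ μ) {A : Set X} (hA : MeasurableSet A)
    (hemb : MeasurableEmbedding (A.domRestrict φ)) (hac : μ ≪ (μ.restrict A).map φ) :
    ∃ S : Lp ℂ 2 μ →L[ℂ] Lp ℂ 2 μ, IsBranchIsometry φ A S := by
  obtain ⟨h, hm, h0, hF⟩ := exists_weight hφ hac
  have hnorm : ∀ g : X → ℂ, AEStronglyMeasurable g μ →
      eLpNorm (A.indicator fun x => h (φ x) * g (φ x)) 2 μ = eLpNorm g 2 μ := by
    intro g hg
    refine eLpNorm_two_eq_of_lintegral_eq ?_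
    rw [lintegral_enorm_sq_indicator hA, ← hF _ (hg.enorm.pow_const 2)]
    simp only [enorm_mul, mul_pow]
  have hmeas : ∀ g : X → ℂ, AEStronglyMeasurable g μ →
      AEStronglyMeasurable (A.indicator fun x => h (φ x) * g (φ x)) μ := fun g hg =>
    (((hm.comp hφ.measurable).aestronglyMeasurable).mul
      (hg.comp_quasiMeasurePreserving hφ)).indicator hA
  have hLp : ∀ g : Lp ℂ 2 μ, MemLp (A.indicator fun x => h (φ x) * g (φ x)) 2 μ := fun g =>
    ⟨hmeas g (Lp.aestronglyMeasurable g),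
      by rw [hnorm g (Lp.aestronglyMeasurable g)]; exact Lp.eLpNorm_lt_top g⟩
  let S : Lp ℂ 2 μ →ₗᵢ[ℂ] Lp ℂ 2 μ :=
    { toFun := fun g => (hLp g).toLp _
      map_add' := fun f g => by
        refine Lp.ext ?_
        filter_upwards [(hLp (f + g)).coeFn_toLp, (hLp f).coeFn_toLp, (hLp g).coeFn_toLp,
          Lp.coeFn_add ((hLp f).toLp _) ((hLp g).toLp _),
          hφ.ae_eq_comp (Lp.coeFn_add f g)] with x h1 h2 h3 h4 h5
        rw [h1, h4, Pi.add_apply, h2, h3]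
        by_cases hx : x ∈ A
        · simp only [Function.comp_apply, Pi.add_apply] at h5
          simp only [indicator_of_mem hx, h5, mul_add]
        · simp [hx]
      map_smul' := fun c g => by
        refine Lp.ext ?_
        filter_upwards [(hLp (c • g)).coeFn_toLp, (hLp g).coeFn_toLp,
          Lp.coeFn_smul c ((hLp g).toLp _), hφ.ae_eq_comp (Lp.coeFn_smul c g)] with x h1 h2 h3 h4
        rw [h1, RingHom.id_apply, h3, Pi.smul_apply, h2]
        by_cases hx : x ∈ A
        · simp only [Function.comp_apply, Pi.smul_apply, smul_eq_mul] at h4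
          simp only [indicator_of_mem hx, h4, smul_eq_mul]
          ring
        · simp [hx]
      norm_map' := fun g => by
        change ‖(hLp g).toLp _‖ = ‖g‖
        rw [Lp.norm_toLp, hnorm g (Lp.aestronglyMeasurable g), Lp.norm_def] }
  have hS : ∀ g, S g =ᵐ[μ] A.indicator fun x => h (φ x) * g (φ x) := fun g => (hLp g).coeFn_toLp
  have hiso : star S.toContinuousLinearMap * S.toContinuousLinearMap = 1 := S.adjoint_comp_self
  refine ⟨S.toContinuousLinearMap, hiso, fun g => ?_, h, h0, hS⟩
  -- Injectivity on `A` lets `g` on `A` be written as `k ∘ φ`; then `k / h` is a preimage of `1_A g`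
  -- under `S`.
  obtain ⟨k, hkm, hk⟩ := hemb.exists_stronglyMeasurable_extend
    (f := fun a : A => g (a : X))
    ((Lp.stronglyMeasurable g).comp_measurable measurable_subtype_coe) (fun _ => ⟨0⟩)
  have hk' : ∀ x ∈ A, k (φ x) = g x := fun x hx => congrFun hk ⟨x, hx⟩
  have hpre : A.indicator (fun x => h (φ x) * ((h (φ x))⁻¹ * k (φ x))) =ᵐ[μ] A.indicator g := by
    filter_upwards [hφ.ae h0] with x hx
    by_cases hxA : x ∈ A
    · simp only [indicator_of_mem hxA, hk' x hxA]
      rw [mul_inv_cancel_left₀ hx]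
    · simp [hxA]
  have hqm : AEStronglyMeasurable (fun y => (h y)⁻¹ * k y) μ :=
    (hm.inv.aestronglyMeasurable).mul hkm.aestronglyMeasurable
  have hq : MemLp (fun y => (h y)⁻¹ * k y) 2 μ := by
    refine ⟨hqm, ?_⟩
    rw [← hnorm _ hqm, eLpNorm_congr_ae hpre]
    exact (eLpNorm_indicator_le _).trans_lt (Lp.eLpNorm_lt_top g)
  have hSq : S (hq.toLp _) =ᵐ[μ] A.indicator g := by
    refine (hS _).trans (.trans ?_ hpre)
    filter_upwards [hφ.ae_eq_comp hq.coeFn_toLp] with x hx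
    simp only [Function.comp_apply] at hx
    by_cases hxA : x ∈ A <;> simp [hxA, hx]
  -- With `q = k / h`: `⟨f, q⟩ = ⟨S f, S q⟩ = ⟨S f, 1_A g⟩ = ⟨S f, g⟩`, since `S f` vanishes off
  -- `A`.
  have hstar : star S.toContinuousLinearMap g = hq.toLp _ := by
    refine ext_inner_left ℂ fun f => ?_
    rw [ContinuousLinearMap.star_eq_adjoint, ContinuousLinearMap.adjoint_inner_right]
    refine Eq.trans ?_ (S.inner_map_map f (hq.toLp _))
    rw [L2.inner_def, L2.inner_def]
    refine integral_congr_ae ?_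
    filter_upwards [hS f, hSq] with x h1 h2
    simp only [LinearIsometry.coe_toContinuousLinearMap, h1, h2]
    by_cases hxA : x ∈ A <;> simp [hxA]
  rw [hstar]
  exact hSq

variable {φ : X → X} {A B : Set X} {S R : Lp ℂ 2 μ →L[ℂ] Lp ℂ 2 μ}

/-- `S` turns the factor `f` into `f ∘ φ`, and what remains is `S (star S g) = 1_A g`, so the weight
disappears. -/
theorem IsBranchIsometry.mul_mulOp_star (hS : IsBranchIsometry φ A S)
    (hφ : Measure.QuasiMeasurePreserving φ μ μ) (f : Lp ℂ ∞ μ) (g : Lp ℂ 2 μ) :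
    S (mulOp f (star S g)) =ᵐ[μ] A.indicator fun x => f (φ x) * g x := by
  obtain ⟨h, -, hh⟩ := hS.exists_weight
  filter_upwards [hh (mulOp f (star S g)), hh (star S g), hS.mul_star g,
    hφ.ae_eq_comp (coeFn_mulOp f (star S g))] with x h1 h2 h3 h4
  rw [h1]
  rw [h2] at h3
  simp only [Function.comp_apply] at h4
  by_cases hx : x ∈ A
  · simp only [indicator_of_mem hx] at h3 ⊢
    rw [h4, ← h3]
    ring
  · simp [hx]

theorem IsBranchIsometry.star_mul_eq_zero (hS : IsBranchIsometry φ A S)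
    (hR : IsBranchIsometry φ B R) (hAB : Disjoint A B) : star S * R = 0 := by
  have h0 : S * (star S * R) = 0 := by
    ext1 g
    refine Lp.ext ?_
    obtain ⟨h, -, hh⟩ := hR.exists_weight
    filter_upwards [hS.mul_star (R g), hh g, Lp.coeFn_zero ℂ 2 μ] with x h1 h2 h3
    simp only [ContinuousLinearMap.mul_def,
      ContinuousLinearMap.comp_apply, zero_apply]
    rw [h1, h3]
    by_cases hx : x ∈ A
    · rw [indicator_of_mem hx, h2, indicator_of_notMem (disjoint_left.1 hAB hx), Pi.zero_apply]
    · rw [indicator_of_notMem hx, Pi.zero_apply]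
  calc star S * R = star S * S * (star S * R) := by rw [hS.isometry, one_mul]
    _ = 0 := by rw [mul_assoc, h0, mul_zero]

end Branch

/-! ### The Cuntz relations -/

section Family

theorem sum_indicator_eq {X : Type*} {N : ℕ} {U : Fin N → Set X}
    (hdisj : ∀ i j, i ≠ j → Disjoint (U i) (U j)) (f : X → ℂ) {x : X} (hx : x ∈ ⋃ i, U i) :
    ∑ i, (U i).indicator f x = f x := by
  obtain ⟨i, hi⟩ := mem_iUnion.1 hx
  rw [Finset.sum_eq_single i, indicator_of_mem hi]
  · exact fun j _ hj => indicator_of_notMem (disjoint_left.1 (hdisj i j hj.symm) hi) f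
  · simp

variable {X : Type*} [MeasurableSpace X] {μ : Measure X} {φ : X → X} {N : ℕ} {U : Fin N → Set X}
  {S : Fin N → Lp ℂ 2 μ →L[ℂ] Lp ℂ 2 μ}

theorem sum_mul_mulOp_mul_star (hS : ∀ i, IsBranchIsometry φ (U i) (S i))
    (hφ : Measure.QuasiMeasurePreserving φ μ μ)
    (hdisj : ∀ i j, i ≠ j → Disjoint (U i) (U j)) (hcov : ∀ᵐ x ∂μ, x ∈ ⋃ i, U i)
    (f : Lp ℂ ∞ μ) : ∑ i, S i * mulOp f * star (S i) = mulOp (compLinfty φ hφ f) := by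
  ext1 g
  refine Lp.ext ?_
  simp only [sum_apply, ContinuousLinearMap.mul_def,
    ContinuousLinearMap.comp_apply]
  filter_upwards [Lp.coeFn_finsetSum Finset.univ fun i => S i (mulOp f (star (S i) g)), hcov,
    ae_all_iff.2 fun i => (hS i).mul_mulOp_star hφ f g, coeFn_mulOp (compLinfty φ hφ f) g,
    coeFn_compLinfty φ hφ f] with x h1 h2 h3 h4 h5
  rw [h1, h4, h5, Finset.sum_apply, Finset.sum_congr rfl fun i _ => h3 i,
    sum_indicator_eq hdisj _ h2, Function.comp_apply]

theorem isCuntzFamily_of_isBranchIsometry (hS : ∀ i, IsBranchIsometry φ (U i) (S i))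
    (hdisj : ∀ i j, i ≠ j → Disjoint (U i) (U j)) (hcov : ∀ᵐ x ∂μ, x ∈ ⋃ i, U i) :
    IsCuntzFamily S where
  isometry i := (hS i).isometry
  orthogonal i j hij := (hS i).star_mul_eq_zero (hS j) (hdisj i j hij)
  sum_eq_one := by
    ext1 g
    refine Lp.ext ?_
    simp only [sum_apply, ContinuousLinearMap.mul_def,
      ContinuousLinearMap.comp_apply]
    filter_upwards [Lp.coeFn_finsetSum Finset.univ fun i => S i (star (S i) g), hcov,
      ae_all_iff.2 fun i => (hS i).mul_star g] with x h1 h2 h3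
    rw [h1, Finset.sum_apply, Finset.sum_congr rfl fun i _ => h3 i, sum_indicator_eq hdisj _ h2]
    rfl

end Family

/-! ### Operators commuting with a generating π-system -/

section Commutant

/-- Two integrable functions whose integrals agree on a π-system that contains the whole space
and generates the measurable sets up to null sets agree almost everywhere. -/
theorem ae_eq_of_setIntegral_eq_of_isPiSystem {X : Type*} [MeasurableSpace X]
    {μ : Measure X} {C : Set (Set X)} (hC : IsPiSystem C)
    (hCm : ∀ s ∈ C, MeasurableSet s) (huniv : univ ∈ C)
    (hgen : ∀ E, MeasurableSet E →
      ∃ F, MeasurableSet[MeasurableSpace.generateFrom C] F ∧ E =ᵐ[μ] F)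
    {f g : X → ℂ} (hf : Integrable f μ) (hg : Integrable g μ)
    (hfg : ∀ s ∈ C, ∫ x in s, f x ∂μ = ∫ x in s, g x ∂μ) : f =ᵐ[μ] g := by
  have hle : MeasurableSpace.generateFrom C ≤ ‹MeasurableSpace X› :=
    MeasurableSpace.generateFrom_le hCm
  have key : ∀ F, MeasurableSet[MeasurableSpace.generateFrom C] F →
      ∫ x in F, f x ∂μ = ∫ x in F, g x ∂μ := by
    refine MeasurableSpace.induction_on_inter rfl hC (by simp) hfg ?_ ?_
    · intro t ht h
      have := hfg univ huniv
      rw [setIntegral_univ, setIntegral_univ, ← integral_add_compl (hle t ht) hf,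
        ← integral_add_compl (hle t ht) hg, h] at this
      exact add_left_cancel this
    · intro s hd hs h
      refine (hasSum_integral_iUnion (fun i => hle _ (hs i)) hd hf.integrableOn).unique ?_
      simpa only [h] using hasSum_integral_iUnion (fun i => hle _ (hs i)) hd hg.integrableOn
  refine Integrable.ae_eq_of_forall_setIntegral_eq f g hf hg fun E hE _ => ?_
  obtain ⟨F, hF, hEF⟩ := hgen E hE
  rw [setIntegral_congr_set hEF, setIntegral_congr_set hEF, key F hF]

variable {X : Type*} [MeasurableSpace X] {μ : Measure X} [IsFiniteMeasure μ]

/-- Multiplication by the indicator function of a measurable set. -/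
noncomputable def indOp (μ : Measure X) [IsFiniteMeasure μ] {E : Set X} (hE : MeasurableSet E) :
    Lp ℂ 2 μ →L[ℂ] Lp ℂ 2 μ :=
  mulOp (indicatorConstLp ∞ hE (measure_ne_top μ E) 1)

theorem coeFn_indOp {E : Set X} (hE : MeasurableSet E) (g : Lp ℂ 2 μ) :
    indOp μ hE g =ᵐ[μ] E.indicator g := by
  filter_upwards [coeFn_mulOp (indicatorConstLp ∞ hE (measure_ne_top μ E) (1 : ℂ)) g,
    indicatorConstLp_coeFn (p := ∞) (hs := hE) (hμs := measure_ne_top μ E) (c := (1 : ℂ))]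
    with x h1 h2
  rw [indOp, h1, h2]
  by_cases hx : x ∈ E <;> simp [hx]

theorem inner_indOp {E : Set X} (hE : MeasurableSet E) (b a : Lp ℂ 2 μ) :
    inner ℂ b (indOp μ hE a) = ∫ x in E, inner ℂ (b x) (a x) ∂μ := by
  rw [L2.inner_def, ← integral_indicator hE]
  refine integral_congr_ae ?_
  filter_upwards [coeFn_indOp hE a] with x hx
  rw [hx]
  by_cases hxE : x ∈ E <;> simp [hxE]

/-- An operator that commutes with the indicator functions of a generating π-system is the
multiplication by the image of the constant function `1`. -/
theorem ae_eq_mul_of_commute_indOp {C : Set (Set X)} (hC : IsPiSystem C)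
    (hCm : ∀ s ∈ C, MeasurableSet s) (huniv : univ ∈ C)
    (hgen : ∀ E, MeasurableSet E →
      ∃ F, MeasurableSet[MeasurableSpace.generateFrom C] F ∧ E =ᵐ[μ] F)
    {T : Lp ℂ 2 μ →L[ℂ] Lp ℂ 2 μ}
    (hT : ∀ s (hs : s ∈ C), Commute T (indOp μ (hCm s hs))) (a : Lp ℂ 2 μ) :
    T a =ᵐ[μ] fun x => T (Lp.const 2 μ 1) x * a x := by
  -- For `s` in `C`, `⟨T^* b, 1_s a⟩ = ⟨b, T (1_s a)⟩ = ⟨b, 1_s T a⟩`, so both integrands have the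
  -- same integral over `s`.
  have key : ∀ b a : Lp ℂ 2 μ,
      (fun x => inner ℂ ((star T b) x) (a x)) =ᵐ[μ] fun x => inner ℂ (b x) (T a x) := by
    intro b a
    refine ae_eq_of_setIntegral_eq_of_isPiSystem hC hCm huniv hgen
      (L2.integrable_inner _ _) (L2.integrable_inner _ _) fun s hs => ?_
    rw [← inner_indOp (hCm s hs), ← inner_indOp (hCm s hs), ContinuousLinearMap.star_eq_adjoint,
      ContinuousLinearMap.adjoint_inner_left]
    exact congrArg (inner ℂ b) (DFunLike.congr_fun (hT s hs).eq a)
  -- With `b = 1`, `T a` is `a` times the conjugate of `T^* 1`; taking `a = 1` identifies that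
  -- factor as `T 1`.
  filter_upwards [key (Lp.const 2 μ 1) a, key (Lp.const 2 μ 1) (Lp.const 2 μ 1),
    Lp.coeFn_const 2 μ (1 : ℂ)] with x h1 h2 h3
  simp only [h3, Function.const_apply, RCLike.inner_apply, map_one, one_mul, mul_one] at h1 h2
  rw [← h1, ← h2, mul_comm]

end Commutant

/-! ### Cylinder sets -/

section Cylinder

variable {X : Type*} {φ : X → X} {N : ℕ} {U : Fin N → Set X}

theorem cylinder_succ {k : ℕ} (w : Fin (k + 1) → Fin N) :
    cylinder φ U w = U (w 0) ∩ φ ⁻¹' cylinder φ U (Fin.tail w) := by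
  ext x
  simp only [cylinder, mem_ofPred_eq, mem_inter_iff, mem_preimage, Fin.forall_fin_succ,
    Fin.val_zero, Function.iterate_zero, id_eq, Fin.val_succ, Function.iterate_succ_apply,
    Fin.tail]

theorem cylinder_zero (w : Fin 0 → Fin N) : cylinder φ U w = univ :=
  eq_univ_of_forall fun _ j => j.elim0

theorem measurableSet_cylinder [MeasurableSpace X] (hφ : Measurable φ)
    (hU : ∀ i, MeasurableSet (U i)) {k : ℕ} (w : Fin k → Fin N) :
    MeasurableSet (cylinder φ U w) := by
  rw [cylinder, ofPred_forall]
  exact MeasurableSet.iInter fun j => (hφ.iterate j) (hU (w j))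

/-- As the `U i` are disjoint, a common point forces `w` to be a prefix of `v`. Cylinders are thus
nested or disjoint. -/
theorem cylinder_subset_of_le (hdisj : ∀ i j, i ≠ j → Disjoint (U i) (U j)) {k l : ℕ}
    (w : Fin k → Fin N) (v : Fin l → Fin N) (hkl : k ≤ l)
    (hne : (cylinder φ U w ∩ cylinder φ U v).Nonempty) :
    cylinder φ U v ⊆ cylinder φ U w := by
  obtain ⟨x, hxw, hxv⟩ := hne
  intro y hy j
  have hj : w j = v (Fin.castLE hkl j) := by
    by_contra h
    exact disjoint_left.1 (hdisj _ _ h) (hxw j) (hxv (Fin.castLE hkl j))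
  rw [hj]
  exact hy (Fin.castLE hkl j)

theorem isPiSystem_cylinder (hdisj : ∀ i j, i ≠ j → Disjoint (U i) (U j)) :
    IsPiSystem {s | ∃ (k : ℕ) (w : Fin k → Fin N), s = cylinder φ U w} := by
  rintro _ ⟨k, w, rfl⟩ _ ⟨l, v, rfl⟩ hne
  rcases le_total k l with h | h
  · exact ⟨l, v, inter_eq_right.2 (cylinder_subset_of_le hdisj w v h hne)⟩
  · exact ⟨k, w, inter_eq_left.2 (cylinder_subset_of_le hdisj v w h (inter_comm _ _ ▸ hne))⟩

end Cylinder

/-! ### The commutant of the family is trivial -/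

section FamilyCommutant

variable {X : Type*} [MeasurableSpace X] {μ : Measure X} [IsFiniteMeasure μ] {φ : X → X} {N : ℕ}
  {U : Fin N → Set X} {S : Fin N → Lp ℂ 2 μ →L[ℂ] Lp ℂ 2 μ} {T : Lp ℂ 2 μ →L[ℂ] Lp ℂ 2 μ}

theorem IsBranchIsometry.mul_indOp_mul_star {A E : Set X} {S : Lp ℂ 2 μ →L[ℂ] Lp ℂ 2 μ}
    (hS : IsBranchIsometry φ A S) (hφ : Measure.QuasiMeasurePreserving φ μ μ)
    (hE : MeasurableSet E) (hAE : MeasurableSet (A ∩ φ ⁻¹' E)) :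
    S * indOp μ hE * star S = indOp μ hAE := by
  ext1 g
  refine Lp.ext ?_
  filter_upwards [hS.mul_mulOp_star hφ (indicatorConstLp ∞ hE (measure_ne_top μ E) 1) g,
    coeFn_indOp hAE g, hφ.ae_eq_comp (indicatorConstLp_coeFn (p := ∞) (hs := hE)
      (hμs := measure_ne_top μ E) (c := (1 : ℂ)))] with x h1 h2 h3
  simp only [Function.comp_apply] at h3
  rw [h2]
  refine h1.trans ?_
  by_cases hx : x ∈ A
  · by_cases hx' : φ x ∈ E <;> simp [hx, hx', h3]
  · simp [hx]

theorem commute_indOp_cylinder (hS : ∀ i, IsBranchIsometry φ (U i) (S i))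
    (hφ : Measure.QuasiMeasurePreserving φ μ μ) (hU : ∀ i, MeasurableSet (U i))
    (hT : ∀ i, Commute T (S i)) (hT' : ∀ i, Commute T (star (S i))) {k : ℕ} (w : Fin k → Fin N)
    (hw : MeasurableSet (cylinder φ U w)) : Commute T (indOp μ hw) := by
  induction k with
  | zero =>
    have : indOp μ hw = 1 := by
      ext1 g
      refine Lp.ext ?_
      filter_upwards [coeFn_indOp hw g] with x hx
      rw [hx, cylinder_zero, indicator_univ]
      rfl
    rw [this]
    exact Commute.one_right T
  | succ k ih =>
    have hm := measurableSet_cylinder hφ.measurable hU (Fin.tail w)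
    have hm' : MeasurableSet (U (w 0) ∩ φ ⁻¹' cylinder φ U (Fin.tail w)) := cylinder_succ w ▸ hw
    have : indOp μ hw = S (w 0) * indOp μ hm * star (S (w 0)) := by
      rw [(hS (w 0)).mul_indOp_mul_star hφ hm hm']
      simp only [indOp, cylinder_succ w]
    rw [this]
    exact ((hT _).mul_right (ih _ hm)).mul_right (hT' _)

theorem eq_smul_one_of_commute (hS : ∀ i, IsBranchIsometry φ (U i) (S i))
    (herg : QuasiErgodic φ μ) (hU : ∀ i, MeasurableSet (U i))
    (hdisj : ∀ i j, i ≠ j → Disjoint (U i) (U j)) (hcov : ∀ᵐ x ∂μ, x ∈ ⋃ i, U i)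
    (hgen : CylindersGenerate μ φ U)
    (hT : ∀ i, Commute T (S i)) (hT' : ∀ i, Commute T (star (S i))) :
    ∃ c : ℂ, T = c • 1 := by
  have hφ := herg.toQuasiMeasurePreserving
  have hmul := ae_eq_mul_of_commute_indOp (isPiSystem_cylinder hdisj)
    (by rintro _ ⟨k, w, rfl⟩; exact measurableSet_cylinder hφ.measurable hU w)
    ⟨0, Fin.elim0, (cylinder_zero _).symm⟩ hgen (T := T)
    (by rintro _ ⟨k, w, rfl⟩; exact commute_indOp_cylinder hS hφ hU hT hT' w _)
  set one : Lp ℂ 2 μ := Lp.const 2 μ 1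
  -- On `U i`, `T (S i 1) = S i (T 1)` reads `T 1 · (h ∘ φ) = (h ∘ φ) · (T 1 ∘ φ)`, and `h ∘ φ`
  -- cancels.
  have hinv : ∀ i, ∀ᵐ x ∂μ, x ∈ U i → T one (φ x) = T one x := by
    intro i
    obtain ⟨h, h0, hh⟩ := (hS i).exists_weight
    have hcomm : T (S i one) = S i (T one) := DFunLike.congr_fun (hT i).eq one
    have h1 := hmul (S i one)
    rw [hcomm] at h1
    filter_upwards [h1, hh one, hh (T one), hφ.ae h0,
      hφ.ae_eq_comp (Lp.coeFn_const 2 μ (1 : ℂ))] with x h1 h2 h3 h4 h5 hx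
    simp only [Function.comp_apply, Function.const_apply] at h5
    rw [h2, h3, indicator_of_mem hx, indicator_of_mem hx, h5, mul_one, mul_comm] at h1
    exact mul_right_cancel₀ h4 h1
  obtain ⟨c, hc⟩ := herg.ae_eq_const_of_ae_eq_comp_ae (Lp.aestronglyMeasurable (T one)) <| by
    filter_upwards [ae_all_iff.2 hinv, hcov] with x h1 h2
    obtain ⟨i, hi⟩ := mem_iUnion.1 h2
    exact h1 i hi
  refine ⟨c, ?_⟩
  ext1 g
  refine Lp.ext ?_
  filter_upwards [hmul g, hc, Lp.coeFn_smul c g] with x h1 h2 h3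
  rw [h1, h2]
  exact h3.symm

end FamilyCommutant

/-! ### Fixed points, commutants and invariant subspaces -/

section Abstract

theorem mul_starProjection_eq {H : Type*} [NormedAddCommGroup H] [InnerProductSpace ℂ H]
    {K : Submodule ℂ H} [K.HasOrthogonalProjection] {R : H →L[ℂ] H} (hR : ∀ x ∈ K, R x ∈ K) :
    K.starProjection * (R * K.starProjection) = R * K.starProjection := by
  ext1 x
  exact K.starProjection_eq_self_iff.2 (hR _ (K.starProjection_apply_mem x))

variable {H : Type*} [NormedAddCommGroup H] [InnerProductSpace ℂ H] [CompleteSpace H] {N : ℕ}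
  {S : Fin N → H →L[ℂ] H}

/-- Multiplying `∑ j, S j * T * star (S j) = T` on the right by `S i` leaves only `S i * T` on the
left. -/
theorem IsCuntzFamily.commute_of_fixed (hS : IsCuntzFamily S) {T : H →L[ℂ] H}
    (hT : hS.endomorphism T = T) (i : Fin N) : Commute T (S i) := by
  have hT' : ∑ j, S j * T * star (S j) = T := hT
  change T * S i = S i * T
  conv_lhs => rw [← hT']
  rw [Finset.sum_mul, Finset.sum_eq_single i]
  · rw [mul_assoc, hS.isometry, mul_one]
  · intro j _ hj
    rw [mul_assoc, hS.orthogonal j i hj, mul_zero]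
  · simp

theorem IsCuntzFamily.commute_star_of_fixed (hS : IsCuntzFamily S) {T : H →L[ℂ] H}
    (hT : hS.endomorphism T = T) (i : Fin N) : Commute T (star (S i)) := by
  have h : hS.endomorphism (star T) = star T := by rw [map_star, hT]
  have := (hS.commute_of_fixed h i).star_star
  rwa [star_star] at this

theorem IsCuntzFamily.isErgodicEndomorphism (hS : IsCuntzFamily S)
    (h : ∀ T : H →L[ℂ] H, (∀ i, Commute T (S i)) → (∀ i, Commute T (star (S i))) →
      ∃ c : ℂ, T = c • 1) : IsErgodicEndomorphism hS.endomorphism := by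
  refine Subset.antisymm (fun T hT => ?_) ?_
  · obtain ⟨c, hc⟩ := h T (hS.commute_of_fixed hT) (hS.commute_star_of_fixed hT)
    exact ⟨c, hc.symm⟩
  · rintro _ ⟨c, rfl⟩
    change hS.endomorphism (c • 1) = c • 1
    rw [map_smul, map_one]

/-- With `P` the projection, invariance under `R` gives `P R P = R P`; invariance under `star R`
gives, after taking adjoints, `P R P = P R`. -/
theorem commute_starProjection {K : Submodule ℂ H} [K.HasOrthogonalProjection] {R : H →L[ℂ] H}
    (hR : ∀ x ∈ K, R x ∈ K) (hR' : ∀ x ∈ K, star R x ∈ K) : Commute K.starProjection R := by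
  have hsa : star K.starProjection = K.starProjection := isSelfAdjoint_starProjection K
  have h1 := mul_starProjection_eq hR
  have h2 := congrArg star (mul_starProjection_eq hR')
  simp only [star_mul, star_star, hsa] at h2
  rw [mul_assoc] at h2
  exact h2.symm.trans h1

theorem isIrreducibleRep_cuntzAlgebra [Nontrivial H]
    (h : ∀ T : H →L[ℂ] H, (∀ i, Commute T (S i)) → (∀ i, Commute T (star (S i))) →
      ∃ c : ℂ, T = c • 1) : IsIrreducibleRep (cuntzAlgebra S).subtype := by
  refine ⟨inferInstance, fun K hK hinv => ?_⟩
  have : CompleteSpace K := hK.completeSpace_coe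
  have hmem : ∀ i, S i ∈ cuntzAlgebra S := fun i =>
    StarSubalgebra.le_topologicalClosure _ (StarAlgebra.subset_adjoin ℂ _ (mem_range_self i))
  have h1 : ∀ i, ∀ x ∈ K, S i x ∈ K := fun i => hinv ⟨S i, hmem i⟩
  have h2 : ∀ i, ∀ x ∈ K, star (S i) x ∈ K := fun i =>
    hinv ⟨star (S i), star_mem (hmem i)⟩
  obtain ⟨c, hc⟩ := h K.starProjection (fun i => commute_starProjection (h1 i) (h2 i))
    (fun i => commute_starProjection (h2 i) (by simpa only [star_star] using h1 i))
  have happ : ∀ x, K.starProjection x = c • x := fun x => by rw [hc]; rfl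
  rcases eq_or_ne c 0 with rfl | hc0
  · left
    rw [Submodule.eq_bot_iff]
    intro x hx
    rw [← K.starProjection_eq_self_iff.2 hx, happ, zero_smul]
  · right
    rw [Submodule.eq_top_iff']
    intro x
    have := K.starProjection_apply_mem (c⁻¹ • x)
    rwa [happ, smul_inv_smul₀ hc0] at this

end Abstract

/-! ### Measure theory of the decomposition -/

section Decomposition

theorem IsDecomposition.ae_mem_iUnion {X : Type*} [TopologicalSpace X] [MeasurableSpace X]
    {μ : Measure X} {φ : X → X} {N : ℕ} {U : Fin N → Set X} (hU : IsDecomposition φ U)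
    (hUnull : ∀ i, μ (frontier (U i)) = 0) : ∀ᵐ x ∂μ, x ∈ ⋃ i, U i := by
  have h : ∀ᵐ x ∂μ, ∀ i, x ∉ frontier (U i) :=
    ae_all_iff.2 fun i => measure_eq_zero_iff_ae_notMem.1 (hUnull i)
  filter_upwards [h] with x hx
  obtain ⟨i, hi⟩ := mem_iUnion.1 (hU.cover.symm ▸ mem_univ x)
  exact mem_iUnion.2 ⟨i, hi.resolve_right (hx i)⟩

variable {X : Type*} [TopologicalSpace X] [MeasurableSpace X] [BorelSpace X] {μ : Measure X}
  {φ : X → X} {N : ℕ} {U : Fin N → Set X}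

/-- All `U j` have the same image, so by surjectivity a point outside it comes from the null set
outside `⋃ j, U j`, whose image is null. -/
theorem IsDecomposition.measure_compl_image (hU : IsDecomposition φ U)
    (hUnull : ∀ i, μ (frontier (U i)) = 0) (hsurj : Function.Surjective φ)
    (hnull : PreservesNullSets μ φ) (i : Fin N) : μ (φ '' U i)ᶜ = 0 := by
  refine measure_mono_null (t := φ '' (⋃ j, U j)ᶜ) ?_
    (hnull _ (MeasurableSet.iUnion fun j => (hU.isOpen j).measurableSet).compl
      (hU.ae_mem_iUnion hUnull))
  intro y hy
  obtain ⟨x, rfl⟩ := hsurj y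
  refine ⟨x, fun hx => hy ?_, rfl⟩
  obtain ⟨j, hj⟩ := mem_iUnion.1 hx
  rw [hU.image_eq i j]
  exact mem_image_of_mem φ hj

/-- If `U i ∩ φ⁻¹ E` is null, so is its image `E ∩ φ (U i)`; the rest of `E` lies in the null
complement of `φ (U i)`. -/
theorem IsDecomposition.absolutelyContinuous_map (hU : IsDecomposition φ U)
    (hUnull : ∀ i, μ (frontier (U i)) = 0) (hφ : Measurable φ) (hsurj : Function.Surjective φ)
    (hnull : PreservesNullSets μ φ) (i : Fin N) : μ ≪ (μ.restrict (U i)).map φ := by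
  refine Measure.AbsolutelyContinuous.mk fun E hE h0 => ?_
  rw [Measure.map_apply hφ hE, Measure.restrict_apply (hφ hE)] at h0
  have h1 := hnull _ ((hφ hE).inter (hU.isOpen i).measurableSet) h0
  refine measure_mono_null ?_
    (measure_union_null h1 (hU.measure_compl_image hUnull hsurj hnull i))
  intro y hy
  by_cases hyi : y ∈ φ '' U i
  · obtain ⟨x, hx, rfl⟩ := hyi
    exact Or.inl ⟨x, ⟨hy, hx⟩, rfl⟩
  · exact Or.inr hyi

theorem IsDecomposition.measurableEmbedding_restrict (hU : IsDecomposition φ U)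
    (hφ : IsLocalHomeomorph φ) (i : Fin N) : MeasurableEmbedding ((U i).domRestrict φ) :=
  ((hφ.comp
    (hU.isOpen i).isOpenEmbedding_subtypeVal.isLocalHomeomorph).isOpenEmbedding_of_injective
    (injOn_iff_injective.1 (hU.injOn i))).measurableEmbedding

end Decomposition

end CuntzErgodic

theorem theorem3p2 {X : Type*} [TopologicalSpace X] [CompactSpace X] [T2Space X]
    [MeasurableSpace X] [BorelSpace X]
    (μ : Measure X) [IsProbabilityMeasure μ] [μ.Regular]
    (N : ℕ) (hN : 1 < N)
    (φ : X → X) (hφ : IsLocalHomeomorph φ) (hcard : ∀ x, (φ ⁻¹' {x}).encard = N)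
    (U : Fin N → Set X) (hU : CuntzErgodic.IsDecomposition φ U)
    (hUnull : ∀ i, μ (frontier (U i)) = 0)
    (herg : QuasiErgodic φ μ) (hnull : CuntzErgodic.PreservesNullSets μ φ)
    (hgen : CuntzErgodic.CylindersGenerate μ φ U) :
    ∃ (S : Fin N → Lp ℂ 2 μ →L[ℂ] Lp ℂ 2 μ) (hS : CuntzErgodic.IsCuntzFamily S),
      (∀ f : Lp ℂ ∞ μ, hS.endomorphism (CuntzErgodic.mulOp f) =
        CuntzErgodic.mulOp (CuntzErgodic.compLinfty φ herg.toQuasiMeasurePreserving f)) ∧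
      CuntzErgodic.IsErgodicEndomorphism hS.endomorphism ∧
      CuntzErgodic.IsIrreducibleRep (CuntzErgodic.cuntzAlgebra S).subtype := by
  have hqmp := herg.toQuasiMeasurePreserving
  have hsurj : Function.Surjective φ := fun x => by
    have hne : (φ ⁻¹' {x}).Nonempty := by
      rw [← encard_ne_zero, hcard x]
      exact_mod_cast (Nat.zero_lt_of_lt hN).ne'
    exact hne
  have hUm : ∀ i, MeasurableSet (U i) := fun i => (hU.isOpen i).measurableSet
  have hcov := hU.ae_mem_iUnion hUnull
  choose S hS using fun i => CuntzErgodic.exists_isBranchIsometry hqmp (hUm i)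
    (hU.measurableEmbedding_restrict hφ i)
    (hU.absolutelyContinuous_map hUnull hqmp.measurable hsurj hnull i)
  have hC := CuntzErgodic.isCuntzFamily_of_isBranchIsometry hS hU.disjoint hcov
  have hcomm : ∀ T : Lp ℂ 2 μ →L[ℂ] Lp ℂ 2 μ, (∀ i, Commute T (S i)) →
      (∀ i, Commute T (star (S i))) → ∃ c : ℂ, T = c • 1 := fun T =>
    CuntzErgodic.eq_smul_one_of_commute hS herg hUm hU.disjoint hcov hgen
  have : Nontrivial (Lp ℂ 2 μ) := by
    refine ⟨Lp.const 2 μ 1, 0, fun h => ?_⟩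
    have hf : ∀ᵐ _ ∂μ, False := by
      filter_upwards [Lp.coeFn_const 2 μ (1 : ℂ), Lp.coeFn_zero ℂ 2 μ] with x h1 h2
      rw [h, h2] at h1
      simp at h1
    exact hf.exists.choose_spec
  exact ⟨S, hC, CuntzErgodic.sum_mul_mulOp_mul_star hS hqmp hU.disjoint hcov,
    hC.isErgodicEndomorphism hcomm, CuntzErgodic.isIrreducibleRep_cuntzAlgebra hcomm⟩
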